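/- A \emph{skew brace} is a set $B$ with two (not necessarily abelian) group structures $(B,+)$ and $(B,\circ)$ such that $a\circ(b+c)=a\circ b-a+a\circ c$ for all $a,b,c\in B$. Put $\lambda_a(b)=-a+a\circ b$ and $a\ast b=\lambda_a(b)-b$. An \emph{ideal} of $B$ is a subgroup of $(B,+)$ that is normal in $(B,+)$ and in $(B,\circ)$ and invariant under all $\lambda_a$; for an ideal $I$ the quotient $B/I$ is again a skew brace. The \emph{annihilator} of $B$ is the ideal $\operatorname{Ann}(B)=\operatorname{Ker}(\lambda)\cap Z(B,+)\cap Z(B,\circ)$. The \emph{upper annihilator series} is defined by $\operatorname{Ann}_0(B)=\{0\}$, $\operatorname{Ann}_{\alpha+1}(B)/\operatorname{Ann}_\alpha(B)=\operatorname{Ann}(B/\operatorname{Ann}_\alpha(B))$ for every ordinal $\alpha$, and $\operatorname{Ann}_\mu(B)=\bigcup_{\beta<\mu}\operatorname{Ann}_\beta(B)$ for limit ordinals $\mu$. The \emph{upper annihilator length} $a(B)$ is the least ordinal $\alpha$ with $\operatorname{Ann}_\alpha(B)=\operatorname{Ann}_{\alpha+1}(B)$, and the \emph{hyper-annihilator}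 is $\overline{\operatorname{Ann}}(B)=\operatorname{Ann}_{a(B)}(B)$, the last term of the series. The skew brace $B$ has \emph{property (S)} if for every $x\in B$ the subgroup $\{b : x\ast b=0\}\cap C_{(B,+)}(x)$ has finite index in $(B,+)$ and the subgroup $\{b : b\ast x=0\}\cap C_{(B,\circ)}(x)$ has finite index in $(B,\circ)$. \textbf{Theorem.} Let $B$ be a skew brace with property (S). Then there is a series of ideals of $B$ $$\{0\}\subseteq S_0\subseteq S_1\subseteq\cdots\subseteq S_n\subseteq S_{n+1}\subseteq\cdots,\qquad S_\omega:=\bigcup_{n\in\mathbb N}S_n=\overline{\operatorname{Ann}}(B),$$ such that: \begin{itemize} \item $S_0$ is torsion-free, i.e. $0$ is its only element of finite order in $(B,+)$, and $S_0\subseteq\operatorname{Ann}(B)$; \item for every integer $i\ge 0$, $S_{i+1}/S_i\subseteq\operatorname{Ann}(B/S_i)$, and $S_{i+1}/S_i$ is the (internal) restricted direct product of a (possibly empty or infinite) family of finite ideals of $B/S_i$, that is, it is generated by these ideals and each of them meets the sum of the others trivially. \end{itemize} In particular, $a(B)\le\omega$. -/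

import Mathlib

universe u

/-- A skew (left) brace: a set with two (not necessarily abelian) group structures, written `+`
(identity `0`, inverse `-a`) and `*` (the operation `∘` of the literature, identity `1`, inverse
`a⁻¹`), linked by the skew left distributive law. -/
class SkewBrace (B : Type u) extends AddGroup B, Group B where
  /-- `a ∘ (b + c) = a ∘ b - a + a ∘ c` -/
  mul_add_eq : ∀ a b c : B, a * (b + c) = a * b - a + a * c

namespace SkewBrace

section Basic

variable {B : Type u} [SkewBrace B]

/-- `λ_a(b) = -a + a ∘ b`. -/
def lam (a b : B) : B := -a + a * b

/-- `a ∗ b = λ_a(b) - b`. -/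
def star (a b : B) : B := lam a b - b

theorem one_eq_zero : (1 : B) = 0 := by
  have h := mul_add_eq (1 : B) 0 0
  simp only [add_zero, one_mul, zero_sub] at h
  have h2 := congrArg Neg.neg h
  simpa using h2.symm

theorem mul_eq_add_lam (a b : B) : a * b = a + lam a b := by simp [lam]

theorem lam_add (a b c : B) : lam a (b + c) = lam a b + lam a c := by
  simp [lam, mul_add_eq, sub_eq_add_neg, add_assoc]

theorem mul_zero_eq (a : B) : a * 0 = a := by rw [← one_eq_zero, mul_one]

theorem lam_zero (a : B) : lam a 0 = 0 := by simp [lam, mul_zero_eq]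

theorem lam_neg (a b : B) : lam a (-b) = -lam a b := by
  rw [eq_neg_iff_add_eq_zero, ← lam_add, neg_add_cancel, lam_zero]

theorem lam_mul (a b c : B) : lam (a * b) c = lam a (lam b c) := by
  have h : lam a (lam b c) = -lam a b + lam a (b * c) := by
    rw [← lam_neg, ← lam_add]
    rfl
  rw [h]
  simp [lam, mul_assoc, add_assoc]

theorem lam_one (b : B) : lam 1 b = b := by simp [lam, one_eq_zero (B := B)]

theorem star_eq_zero_iff (a b : B) : star a b = 0 ↔ lam a b = b := by simp [star, sub_eq_zero]

/-- `Fix^r(x) = {b : x ∗ b = 0}`, a subgroup of `(B,+)`. -/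
def fixR (x : B) : AddSubgroup B where
  carrier := {b | star x b = 0}
  zero_mem' := by simp [star_eq_zero_iff, lam_zero]
  add_mem' := by
    intro a b ha hb
    simp only [Set.mem_ofPred_eq, star_eq_zero_iff] at *
    rw [lam_add, ha, hb]
  neg_mem' := by
    intro a ha
    simp only [Set.mem_ofPred_eq, star_eq_zero_iff] at *
    rw [lam_neg, ha]

/-- `Fix^l(x) = {b : b ∗ x = 0}`, a subgroup of `(B,∘)`. -/
def fixL (x : B) : Subgroup B where
  carrier := {b | star b x = 0}
  one_mem' := by simp [star_eq_zero_iff, lam_one]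
  mul_mem' := by
    intro a b ha hb
    simp only [Set.mem_ofPred_eq, star_eq_zero_iff] at *
    rw [lam_mul, hb, ha]
  inv_mem' := by
    intro a ha
    simp only [Set.mem_ofPred_eq, star_eq_zero_iff] at *
    conv_lhs => rw [← ha]
    rw [← lam_mul, inv_mul_cancel, lam_one]

/-- Property (s) of an element: `Fix^r(x) ∩ C_x^+` has finite index in `(B,+)` and
`Fix^l(x) ∩ C_x^∘` has finite index in `(B,∘)`. -/
def PropertyElt (x : B) : Prop :=
  (fixR x ⊓ AddSubgroup.centralizer {x}).FiniteIndex ∧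
    (fixL x ⊓ Subgroup.centralizer {x}).FiniteIndex

end Basic

/-- Property (S): every element has property (s). -/
def PropertyS (B : Type u) [SkewBrace B] : Prop := ∀ x : B, PropertyElt x

/-- An ideal: a `λ`-invariant subgroup of `(B,+)` that is normal in `(B,+)` and in `(B,∘)`. -/
structure Ideal (B : Type u) [SkewBrace B] extends AddSubgroup B where
  lam_mem' : ∀ (a : B) {x : B}, x ∈ carrier → lam a x ∈ carrier
  add_conj_mem' : ∀ (a : B) {x : B}, x ∈ carrier → a + x - a ∈ carrier
  mul_conj_mem' : ∀ (a : B) {x : B}, x ∈ carrier → a * x * a⁻¹ ∈ carrier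

namespace Ideal

variable {B : Type u} [SkewBrace B]

instance : SetLike (Ideal B) B where
  coe I := I.carrier
  coe_injective := by
    rintro ⟨I, _, _, _⟩ ⟨J, _, _, _⟩ h
    have h' : I = J := SetLike.coe_injective h
    subst h'
    rfl

instance : PartialOrder (Ideal B) := PartialOrder.ofSetLike (Ideal B) B

instance : AddSubgroupClass (Ideal B) B where
  zero_mem I := I.zero_mem'
  add_mem {I} _ _ ha hb := I.add_mem' ha hb
  neg_mem {I} _ ha := I.neg_mem' ha

theorem mem_toAddSubgroup {I : Ideal B} {x : B} : x ∈ I.toAddSubgroup ↔ x ∈ I := Iff.rfl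

theorem lam_mem (I : Ideal B) (a : B) {x : B} (hx : x ∈ I) : lam a x ∈ I := I.lam_mem' a hx

theorem add_conj_mem (I : Ideal B) (a : B) {x : B} (hx : x ∈ I) : a + x - a ∈ I :=
  I.add_conj_mem' a hx

theorem mul_conj_mem (I : Ideal B) (a : B) {x : B} (hx : x ∈ I) : a * x * a⁻¹ ∈ I :=
  I.mul_conj_mem' a hx

instance (I : Ideal B) : I.toAddSubgroup.Normal where
  conj_mem _ hx a := by
    have := I.add_conj_mem a hx
    rwa [sub_eq_add_neg] at this

/-- An ideal is also a subgroup of `(B,∘)`. -/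
def toSubgroup (I : Ideal B) : Subgroup B where
  carrier := I
  one_mem' := by
    rw [one_eq_zero]
    exact zero_mem I
  mul_mem' := by
    intro a b ha hb
    rw [mul_eq_add_lam]
    exact add_mem ha (I.lam_mem a hb)
  inv_mem' := by
    intro a ha
    have h : a⁻¹ = lam a⁻¹ (-a) := by
      rw [lam_neg]
      simp [lam, one_eq_zero (B := B)]
    rw [h]
    exact I.lam_mem _ (neg_mem ha)

instance (I : Ideal B) : I.toSubgroup.Normal where
  conj_mem x hx a := I.mul_conj_mem a hx

/-- The additive and the multiplicative cosets of an ideal coincide. -/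
theorem neg_add_mem_iff (I : Ideal B) (a b : B) : -a + b ∈ I ↔ a⁻¹ * b ∈ I := by
  have h : -a + b = lam a (a⁻¹ * b) := by simp [lam]
  constructor
  · intro hab
    have h2 : a⁻¹ * b = lam a⁻¹ (-a + b) := by
      rw [h, ← lam_mul, inv_mul_cancel, lam_one]
    rw [h2]
    exact I.lam_mem _ hab
  · intro hab
    rw [h]
    exact I.lam_mem _ hab

/-- `B / I`, as the set of additive cosets of `I`. -/
instance : HasQuotient B (Ideal B) where
  Quotient I := B ⧸ I.toAddSubgroup

/-- The canonical projection `B → B / I`. -/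
def proj (I : Ideal B) (b : B) : B ⧸ I := QuotientAddGroup.mk (s := I.toAddSubgroup) b

theorem proj_surjective (I : Ideal B) : Function.Surjective I.proj :=
  QuotientAddGroup.mk_surjective

theorem proj_eq_iff (I : Ideal B) {a b : B} : I.proj a = I.proj b ↔ -a + b ∈ I :=
  QuotientAddGroup.eq

theorem proj_eq_iff_mul (I : Ideal B) {a b : B} :
    I.proj a = I.proj b ↔ (QuotientGroup.mk a : B ⧸ I.toSubgroup) = QuotientGroup.mk b := by
  rw [proj_eq_iff, neg_add_mem_iff]
  exact (QuotientGroup.eq (s := I.toSubgroup)).symm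

noncomputable instance (I : Ideal B) : AddGroup (B ⧸ I) :=
  inferInstanceAs (AddGroup (B ⧸ I.toAddSubgroup))

instance (I : Ideal B) : Mul (B ⧸ I) where
  mul := Quotient.map₂ (· * ·) (by
    intro a a' ha b b' hb
    have ha' : I.proj a = I.proj a' := Quotient.sound ha
    have hb' : I.proj b = I.proj b' := Quotient.sound hb
    refine Quotient.exact (s := QuotientAddGroup.leftRel I.toAddSubgroup) ?_
    change I.proj (a * b) = I.proj (a' * b')
    rw [proj_eq_iff_mul] at *
    rw [QuotientGroup.mk_mul, QuotientGroup.mk_mul, ha', hb'])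

instance (I : Ideal B) : One (B ⧸ I) := ⟨I.proj 1⟩

instance (I : Ideal B) : Inv (B ⧸ I) where
  inv := Quotient.map (·⁻¹) (by
    intro a a' ha
    have ha' : I.proj a = I.proj a' := Quotient.sound ha
    refine Quotient.exact (s := QuotientAddGroup.leftRel I.toAddSubgroup) ?_
    change I.proj a⁻¹ = I.proj a'⁻¹
    rw [proj_eq_iff_mul] at *
    rw [QuotientGroup.mk_inv, QuotientGroup.mk_inv, ha'])

theorem proj_add (I : Ideal B) (a b : B) : I.proj (a + b) = I.proj a + I.proj b := rfl

theorem proj_neg (I : Ideal B) (a : B) : I.proj (-a) = -I.proj a := rfl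

theorem proj_sub (I : Ideal B) (a b : B) : I.proj (a - b) = I.proj a - I.proj b := by
  rw [sub_eq_add_neg, sub_eq_add_neg, proj_add, proj_neg]

theorem proj_zero (I : Ideal B) : I.proj 0 = 0 := rfl

theorem proj_mul (I : Ideal B) (a b : B) : I.proj (a * b) = I.proj a * I.proj b := rfl

theorem proj_inv (I : Ideal B) (a : B) : I.proj a⁻¹ = (I.proj a)⁻¹ := rfl

theorem proj_one (I : Ideal B) : I.proj 1 = 1 := rfl

instance (I : Ideal B) : Group (B ⧸ I) :=
  Group.ofLeftAxioms
    (by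
      intro a b c
      obtain ⟨a, rfl⟩ := I.proj_surjective a
      obtain ⟨b, rfl⟩ := I.proj_surjective b
      obtain ⟨c, rfl⟩ := I.proj_surjective c
      simp only [← proj_mul, mul_assoc])
    (by
      intro a
      obtain ⟨a, rfl⟩ := I.proj_surjective a
      rw [← proj_one, ← proj_mul, one_mul])
    (by
      intro a
      obtain ⟨a, rfl⟩ := I.proj_surjective a
      rw [← proj_inv, ← proj_mul, inv_mul_cancel, proj_one])

/-- The quotient skew brace `B / I`, with both operations induced from `B`. -/
noncomputable instance (I : Ideal B) : SkewBrace (B ⧸ I) where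
  mul_add_eq := by
    intro a b c
    obtain ⟨a, rfl⟩ := I.proj_surjective a
    obtain ⟨b, rfl⟩ := I.proj_surjective b
    obtain ⟨c, rfl⟩ := I.proj_surjective c
    rw [← proj_add, ← proj_mul, ← proj_mul, ← proj_mul, ← proj_sub, ← proj_add, mul_add_eq]

theorem proj_lam (I : Ideal B) (a b : B) : I.proj (lam a b) = lam (I.proj a) (I.proj b) := rfl

/-- The image `(J + I) / I` of an ideal `J` in `B / I`; for `I ⊆ J` this is `J / I`. -/
def map (I J : Ideal B) : Ideal (B ⧸ I) where
  carrier := I.proj '' J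
  zero_mem' := ⟨0, zero_mem J, rfl⟩
  add_mem' := by
    rintro _ _ ⟨a, ha, rfl⟩ ⟨b, hb, rfl⟩
    exact ⟨a + b, add_mem ha hb, rfl⟩
  neg_mem' := by
    rintro _ ⟨a, ha, rfl⟩
    exact ⟨-a, neg_mem ha, rfl⟩
  lam_mem' := by
    rintro c _ ⟨a, ha, rfl⟩
    obtain ⟨c, rfl⟩ := I.proj_surjective c
    exact ⟨lam c a, J.lam_mem c ha, rfl⟩
  add_conj_mem' := by
    rintro c _ ⟨a, ha, rfl⟩
    obtain ⟨c, rfl⟩ := I.proj_surjective c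
    exact ⟨c + a - c, J.add_conj_mem c ha, proj_sub _ _ _⟩
  mul_conj_mem' := by
    rintro c _ ⟨a, ha, rfl⟩
    obtain ⟨c, rfl⟩ := I.proj_surjective c
    exact ⟨c * a * c⁻¹, J.mul_conj_mem c ha, rfl⟩

/-- The preimage in `B` of an ideal of `B / I`. -/
def comap (I : Ideal B) (K : Ideal (B ⧸ I)) : Ideal B where
  carrier := I.proj ⁻¹' K
  zero_mem' := zero_mem K
  add_mem' := fun {_ _} ha hb => add_mem (S := Ideal (B ⧸ I)) ha hb
  neg_mem' := fun {_} ha => neg_mem (S := Ideal (B ⧸ I)) ha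
  lam_mem' := fun a {_} hx => K.lam_mem (I.proj a) hx
  add_conj_mem' := by
    intro a x hx
    have := K.add_conj_mem (I.proj a) hx
    rwa [← proj_add, ← proj_sub] at this
  mul_conj_mem' := fun a {_} hx => K.mul_conj_mem (I.proj a) hx

theorem le_comap (I : Ideal B) (K : Ideal (B ⧸ I)) : I ≤ I.comap K := by
  intro x hx
  have h : I.proj x = 0 := by
    rw [← proj_zero, eq_comm, proj_eq_iff]
    simpa using hx
  change I.proj x ∈ K
  rw [h]
  exact zero_mem K

/-- `J / I` for `J = comap I K` is `K`. -/
theorem map_comap (I : Ideal B) (K : Ideal (B ⧸ I)) : I.map (I.comap K) = K :=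
  SetLike.coe_injective (Set.image_preimage_eq _ I.proj_surjective)

/-- The ideal generated by a subset: the intersection of all ideals containing it. -/
def span (s : Set B) : Ideal B where
  carrier := {x | ∀ I : Ideal B, s ⊆ I → x ∈ I}
  zero_mem' := fun I _ => zero_mem I
  add_mem' := fun ha hb I hI => add_mem (ha I hI) (hb I hI)
  neg_mem' := fun ha I hI => neg_mem (ha I hI)
  lam_mem' := fun a _ hx I hI => I.lam_mem a (hx I hI)
  add_conj_mem' := fun a _ hx I hI => I.add_conj_mem a (hx I hI)
  mul_conj_mem' := fun a _ hx I hI => I.mul_conj_mem a (hx I hI)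

theorem subset_span (s : Set B) : s ⊆ span s := fun _ hx _ hI => hI hx

/-- The zero ideal. -/
instance : Bot (Ideal B) where
  bot := span ∅

theorem mem_bot {x : B} : x ∈ (⊥ : Ideal B) ↔ x = 0 := by
  constructor
  · intro h
    let Z : Ideal B :=
      { (⊥ : AddSubgroup B) with
        lam_mem' := by
          rintro a _ rfl
          exact lam_zero a
        add_conj_mem' := by
          rintro a _ rfl
          change a + 0 - a = 0
          simp
        mul_conj_mem' := by
          rintro a _ rfl
          change a * 0 * a⁻¹ = 0
          rw [mul_zero_eq, mul_inv_cancel, one_eq_zero] }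
    exact h Z (Set.empty_subset _)
  · rintro rfl
    exact zero_mem _

/-- The ideal `I` is torsion-free: `0` is its only element of finite additive order. -/
def IsTorsionFree (I : Ideal B) : Prop := ∀ x ∈ I, IsOfFinAddOrder x → x = 0

/-- `J` is the (internal) restricted direct product of the family of ideals `T`: it is generated
by the `T i` (a sum of ideals is an ideal), and each `T i` meets the sum of the others trivially. -/
structure IsRestrictedDirectProduct {ι : Type*} (J : Ideal B) (T : ι → Ideal B) : Prop where
  eq_iSup : J.toAddSubgroup = ⨆ i, (T i).toAddSubgroup
  indep : iSupIndep fun i => (T i).toAddSubgroup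

/-- In an internal restricted direct product the factors commute elementwise for `+`, and `∘`
agrees with `+` between different factors; so the sum map from the external restricted direct
product is an isomorphism of skew braces. -/
theorem IsRestrictedDirectProduct.mul_eq_add {ι : Type*} {J : Ideal B} {T : ι → Ideal B}
    (h : J.IsRestrictedDirectProduct T) {i j : ι} (hij : i ≠ j) {a b : B} (ha : a ∈ T i)
    (hb : b ∈ T j) : a + b = b + a ∧ a * b = a + b ∧ b * a = a + b := by
  have hd : ∀ x, x ∈ T i → x ∈ T j → x = 0 := by
    intro x hx hx'
    have := (h.indep.pairwiseDisjoint hij)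
    exact AddSubgroup.disjoint_def.1 this hx hx'
  have h1 : a + b = b + a := by
    have h0 : a + b - a - b = 0 := by
      apply hd
      · have h2 : a + b - a - b = a - (b + a - b) := by simp [sub_eq_add_neg, add_assoc]
        rw [h2]
        exact sub_mem ha ((T i).add_conj_mem b ha)
      · exact sub_mem ((T j).add_conj_mem a hb) hb
    rw [sub_eq_zero, sub_eq_iff_eq_add] at h0
    exact h0
  have h2 : a⁻¹ * (b * a * b⁻¹) = 1 := by
    rw [one_eq_zero]
    apply hd
    · exact (T i).toSubgroup.mul_mem ((T i).toSubgroup.inv_mem ha) ((T i).mul_conj_mem b ha)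
    · have h3 : a⁻¹ * (b * a * b⁻¹) = (a⁻¹ * b * a⁻¹⁻¹) * b⁻¹ := by simp [mul_assoc]
      rw [h3]
      exact (T j).toSubgroup.mul_mem ((T j).mul_conj_mem a⁻¹ hb) ((T j).toSubgroup.inv_mem hb)
  have h4 : a * b = b * a := by
    rw [inv_mul_eq_one, eq_mul_inv_iff_mul_eq] at h2
    exact h2
  have h5 : lam a b - b = 0 := by
    apply hd
    · have h6 : lam a b - b = -a + (b + lam b a - b) := by
        rw [← mul_eq_add_lam, ← h4, lam]
        simp [sub_eq_add_neg, add_assoc]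
      rw [h6]
      exact add_mem (neg_mem ha) ((T i).add_conj_mem b ((T i).lam_mem b ha))
    · exact sub_mem ((T j).lam_mem a hb) hb
  have h7 : a * b = a + b := by rw [mul_eq_add_lam, sub_eq_zero.1 h5]
  exact ⟨h1, h7, h4 ▸ h7⟩

end Ideal

section Annihilator

variable (B : Type u) [SkewBrace B]

/-- The annihilator `Ann(B) = Ker(λ) ∩ Z(B,+) ∩ Z(B,∘)`, as an ideal of `B`. -/
def ann : Ideal B where
  carrier := {x | (∀ b : B, lam x b = b) ∧ x ∈ AddSubgroup.center B ∧ x ∈ Subgroup.center B}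
  zero_mem' := by
    refine ⟨fun b => ?_, zero_mem _, ?_⟩
    · rw [← one_eq_zero, lam_one]
    · rw [← one_eq_zero]
      exact one_mem _
  add_mem' := by
    rintro x y ⟨hx, hx', hx''⟩ ⟨hy, hy', hy''⟩
    have h : x + y = x * y := by rw [mul_eq_add_lam, hx]
    refine ⟨fun b => ?_, add_mem hx' hy', ?_⟩
    · rw [h, lam_mul, hy, hx]
    · rw [h]
      exact mul_mem hx'' hy''
  neg_mem' := by
    rintro x ⟨hx, hx', hx''⟩
    have h : -x = x⁻¹ := by
      rw [neg_eq_iff_add_eq_zero]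
      have := mul_eq_add_lam x x⁻¹
      rw [hx, mul_inv_cancel, one_eq_zero] at this
      exact this.symm
    refine ⟨fun b => ?_, neg_mem hx', ?_⟩
    · rw [h]
      conv_lhs => rw [← hx b]
      rw [← lam_mul, inv_mul_cancel, lam_one]
    · rw [h]
      exact inv_mem hx''
  lam_mem' := by
    rintro a x ⟨hx, hx', hx''⟩
    have h : lam a x = x := by
      rw [lam, Subgroup.mem_center_iff.1 hx'', mul_eq_add_lam, hx,
        ← AddSubgroup.mem_center_iff.1 hx', neg_add_cancel_left]
    rw [h]
    exact ⟨hx, hx', hx''⟩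
  add_conj_mem' := by
    rintro a x ⟨hx, hx', hx''⟩
    rw [AddSubgroup.mem_center_iff.1 hx', add_sub_cancel_right]
    exact ⟨hx, hx', hx''⟩
  mul_conj_mem' := by
    rintro a x ⟨hx, hx', hx''⟩
    rw [Subgroup.mem_center_iff.1 hx'', mul_inv_cancel_right]
    exact ⟨hx, hx', hx''⟩

/-- The upper annihilator series: `Ann_0(B) = 0`, `Ann_{α+1}(B) / Ann_α(B) = Ann(B / Ann_α(B))`,
and at limit ordinals the union of the earlier terms (written as the ideal which that union
generates; `coe_annSeries_limit` shows that it is the union itself). -/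
noncomputable def annSeries (α : Ordinal.{u}) : Ideal B :=
  Ordinal.limitRecOn α ⊥ (fun _ I => I.comap (ann (B ⧸ I)))
    (fun μ _ F => Ideal.span (⋃ (β : Ordinal.{u}) (h : β < μ), (F β h : Set B)))

theorem annSeries_zero : annSeries B 0 = ⊥ := Ordinal.limitRecOn_zero ..

theorem annSeries_add_one (α : Ordinal.{u}) :
    annSeries B (α + 1) = (annSeries B α).comap (ann (B ⧸ annSeries B α)) :=
  Ordinal.limitRecOn_add_one ..

theorem annSeries_limit {μ : Ordinal.{u}} (hμ : Order.IsSuccLimit μ) :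
    annSeries B μ = Ideal.span (⋃ (β : Ordinal.{u}) (_ : β < μ), (annSeries B β : Set B)) :=
  Ordinal.limitRecOn_limit _ _ _ _ hμ

theorem annSeries_mono : Monotone (annSeries B) := by
  intro α β
  induction β using Ordinal.limitRecOn with
  | zero =>
    intro h
    rw [nonpos_iff_eq_zero.1 h]
  | add_one β ih =>
    intro h
    rcases h.eq_or_lt with rfl | h
    · exact le_rfl
    · refine (ih (Order.lt_add_one_iff.1 h)).trans ?_
      rw [annSeries_add_one]
      exact Ideal.le_comap _ _
  | limit μ hμ _ =>
    intro h
    rcases h.eq_or_lt with rfl | h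
    · exact le_rfl
    · intro x hx
      rw [annSeries_limit B hμ]
      exact Ideal.subset_span _ (Set.mem_iUnion₂.2 ⟨α, h, hx⟩)

theorem coe_annSeries_limit {μ : Ordinal.{u}} (hμ : Order.IsSuccLimit μ) :
    (annSeries B μ : Set B) = ⋃ (β : Ordinal.{u}) (_ : β < μ), (annSeries B β : Set B) := by
  apply Set.Subset.antisymm
  · let U : Ideal B :=
      { carrier := ⋃ (β : Ordinal.{u}) (_ : β < μ), (annSeries B β : Set B)
        zero_mem' := Set.mem_iUnion₂.2 ⟨0, hμ.bot_lt, zero_mem (annSeries B 0)⟩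
        add_mem' := by
          intro a b ha hb
          obtain ⟨α, hα, ha⟩ := Set.mem_iUnion₂.1 ha
          obtain ⟨β, hβ, hb⟩ := Set.mem_iUnion₂.1 hb
          exact Set.mem_iUnion₂.2 ⟨max α β, max_lt hα hβ,
            add_mem (annSeries_mono B (le_max_left α β) ha)
              (annSeries_mono B (le_max_right α β) hb)⟩
        neg_mem' := by
          intro a ha
          obtain ⟨α, hα, ha⟩ := Set.mem_iUnion₂.1 ha
          exact Set.mem_iUnion₂.2 ⟨α, hα, neg_mem (S := Ideal B) ha⟩
        lam_mem' := by
          intro c a ha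
          obtain ⟨α, hα, ha⟩ := Set.mem_iUnion₂.1 ha
          exact Set.mem_iUnion₂.2 ⟨α, hα, Ideal.lam_mem _ c ha⟩
        add_conj_mem' := by
          intro c a ha
          obtain ⟨α, hα, ha⟩ := Set.mem_iUnion₂.1 ha
          exact Set.mem_iUnion₂.2 ⟨α, hα, Ideal.add_conj_mem _ c ha⟩
        mul_conj_mem' := by
          intro c a ha
          obtain ⟨α, hα, ha⟩ := Set.mem_iUnion₂.1 ha
          exact Set.mem_iUnion₂.2 ⟨α, hα, Ideal.mul_conj_mem _ c ha⟩ }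
    intro x hx
    rw [annSeries_limit B hμ] at hx
    exact hx U subset_rfl
  · intro x hx
    obtain ⟨α, hα, hx⟩ := Set.mem_iUnion₂.1 hx
    exact annSeries_mono B hα.le hx

theorem exists_annSeries_eq : ∃ α : Ordinal.{u}, annSeries B α = annSeries B (α + 1) := by
  by_contra! h
  have hs : StrictMono (annSeries B) := by
    intro α β hαβ
    refine lt_of_lt_of_le (lt_of_le_of_ne (annSeries_mono B ?_) (h α))
      (annSeries_mono B (Order.add_one_le_of_lt hαβ))
    exact (Order.lt_add_one_iff.2 le_rfl).le
  exact not_injective_of_ordinal (annSeries B) hs.injective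

/-- The upper annihilator length `a(B)`: the least ordinal `α` with `Ann_α(B) = Ann_{α+1}(B)`
(it exists by `exists_annSeries_eq`). -/
noncomputable def annLength : Ordinal.{u} :=
  sInf {α : Ordinal.{u} | annSeries B α = annSeries B (α + 1)}

/-- The hyper-annihilator: the last term of the upper annihilator series. -/
noncomputable def hyperAnn : Ideal B := annSeries B (annLength B)

theorem annSeries_eq_hyperAnn {α : Ordinal.{u}} (hα : annLength B ≤ α) :
    annSeries B α = hyperAnn B := by
  have hl : annSeries B (annLength B) = annSeries B (annLength B + 1) :=
    csInf_mem (s := {α : Ordinal.{u} | annSeries B α = annSeries B (α + 1)})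
      (exists_annSeries_eq B)
  induction α using Ordinal.limitRecOn with
  | zero =>
    rw [hyperAnn, nonpos_iff_eq_zero.1 hα]
  | add_one α ih =>
    rcases hα.eq_or_lt with h | h
    · rw [← h, hyperAnn]
    · rw [annSeries_add_one, ih (Order.lt_add_one_iff.1 h)]
      rw [annSeries_add_one] at hl
      exact hl.symm
  | limit μ hμ ih =>
    rcases hα.eq_or_lt with h | h
    · rw [← h, hyperAnn]
    · refine le_antisymm ?_ (annSeries_mono B hα)
      intro x hx
      have hx' : x ∈ (annSeries B μ : Set B) := hx
      rw [coe_annSeries_limit B hμ] at hx'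
      obtain ⟨β, hβ, hx'⟩ := Set.mem_iUnion₂.1 hx'
      rw [← ih (max β (annLength B)) (max_lt hβ h) (le_max_right _ _)]
      exact annSeries_mono B (le_max_left _ _) hx'

end Annihilator

end SkewBrace

/-! Property (S) enters only through a finiteness statement: for fixed `x`, each of `star x b`,
`star b x`, `addComm x b` takes finitely many values (`PropertyElt.finiteCommutators`). If these
values lie in the annihilator, they depend additively on `b`, so having finitely many of them forces
finite order, and some positive multiple of `x` lies in the annihilator
(`FiniteCommutators.exists_nsmul_mem_ann`).

Let `S 0` be a maximal torsion-free subgroup of `ann B`, so that `ann B` is torsion modulo `S 0`,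
and let `S (n + 1) / S n` be the subgroup of the annihilator of `B ⧸ S n` generated by elements of
prime order. Subgroups of the annihilator are ideals, so this factor is a direct product of finite
ideals. By induction every annihilator of `B ⧸ S n` is torsion (`exists_nsmul_mem_socleSeries`).

The union exhausts the annihilator series by transfinite induction: the finitely many commutators of
an element of the next term already lie in a single `S n`, so the element is annihilating, hence
torsion, modulo `S n`. Splitting off the primes of its order one at a time brings it into a later `S
N`. Since `S n` lies in the term of index `n + 1`, nothing new appears after `ω`. -/

section AddCommGroup

/-! ### Abelian groups: torsion-free subgroups and socles. -/

variable {M : Type u} [AddCommGroup M]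

/-- A maximal torsion-free subgroup of an abelian group has torsion quotient. -/
theorem exists_torsionFree_addSubgroup_torsion_quotient (M : Type u) [AddCommGroup M] :
    ∃ H : AddSubgroup M, (∀ x ∈ H, IsOfFinAddOrder x → x = 0) ∧
      ∀ x : M, ∃ k : ℕ, 0 < k ∧ k • x ∈ H := by
  obtain ⟨H, -, hH⟩ := zorn_le_nonempty₀
    {H : AddSubgroup M | ∀ x ∈ H, IsOfFinAddOrder x → x = 0}
    (fun c hc hch y hy => ⟨sSup c, fun x hx hfin => by
      rw [AddSubgroup.mem_sSup_of_directedOn ⟨y, hy⟩ hch.directedOn] at hx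
      obtain ⟨K, hK, hx⟩ := hx
      exact hc hK x hx hfin, fun z hz => le_sSup hz⟩)
    ⊥ (fun x hx _ => AddSubgroup.mem_bot.1 hx)
  refine ⟨H, hH.prop, fun x => ?_⟩
  by_contra! hx
  have hint : ∀ m : ℤ, m • x ∈ H → m = 0 := by
    intro m hm
    by_contra h0
    refine hx m.natAbs (Int.natAbs_pos.2 h0) ?_
    rw [← natCast_zsmul]
    rcases Int.natAbs_eq m with h | h
    · rwa [← h]
    · rw [h, neg_smul] at hm
      exact neg_mem_iff.1 hm
  -- Adjoining `x` keeps `H` torsion-free: `k • (h + m • x) = 0` puts `(k * m) • x` in `H`, so `m =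
  -- 0`. This contradicts maximality.
  have hmem : H ⊔ AddSubgroup.zmultiples x ∈
      {H : AddSubgroup M | ∀ x ∈ H, IsOfFinAddOrder x → x = 0} := by
    intro t ht hfin
    obtain ⟨h, hh, z, hz, rfl⟩ := AddSubgroup.mem_sup.1 ht
    obtain ⟨m, rfl⟩ := AddSubgroup.mem_zmultiples_iff.1 hz
    obtain ⟨k, hk, hk0⟩ := isOfFinAddOrder_iff_nsmul_eq_zero.1 hfin
    have hkm : ((k : ℤ) * m) • x ∈ H := by
      have : ((k : ℤ) * m) • x = -(k • h) := by
        rw [mul_smul, natCast_zsmul, eq_neg_iff_add_eq_zero, add_comm, ← nsmul_add, hk0]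
      rw [this]
      exact neg_mem (nsmul_mem hh k)
    have hm : m = 0 := by
      have := hint _ hkm
      simpa [hk.ne'] using this
    subst hm
    rw [zero_smul, add_zero] at hfin ⊢
    exact hH.prop h hh hfin
  have hle := hH.le_of_ge hmem le_sup_left
  refine hx 1 one_pos ?_
  rw [one_smul]
  exact hle (AddSubgroup.mem_sup_right (AddSubgroup.mem_zmultiples x))

/-- By Bézout: a nonzero `n • x` has `n` prime to `p`, so `x` is a multiple of it. -/
theorem isAtom_span_singleton_of_prime_nsmul_eq_zero {p : ℕ} (hp : p.Prime) {x : M} (hx : x ≠ 0)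
    (hpx : p • x = 0) : IsAtom (Submodule.span ℤ {x}) := by
  refine ⟨by simpa using hx, fun a ha => ?_⟩
  rw [Submodule.eq_bot_iff]
  intro y hy
  by_contra hy0
  obtain ⟨n, rfl⟩ := Submodule.mem_span_singleton.1 (ha.le hy)
  have hcop : IsCoprime (p : ℤ) n := by
    refine ((Nat.prime_iff_prime_int.1 hp).coprime_iff_not_dvd).2 fun ⟨m, hm⟩ => hy0 ?_
    rw [hm, mul_comm, mul_smul, natCast_zsmul, hpx, smul_zero]
  obtain ⟨u, v, huv⟩ := hcop
  refine ha.not_ge ((Submodule.span_singleton_le_iff_mem _ _).2 ?_)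
  have hxv : x = v • n • x := by
    conv_lhs => rw [← one_smul ℤ x, ← huv, add_smul, mul_smul, natCast_zsmul, hpx, smul_zero,
      zero_add, mul_smul]
  rw [hxv]
  exact a.smul_mem v hy

/-- A subgroup generated by elements of prime order is a direct sum of finite subgroups. -/
theorem exists_iSupIndep_finite_iSup_eq_closure (s : Set M)
    (hs : ∀ x ∈ s, ∃ p : ℕ, p.Prime ∧ p • x = 0) :
    ∃ (ι : Type u) (T : ι → AddSubgroup M), (∀ j, (T j : Set M).Finite) ∧
      ⨆ j, T j = AddSubgroup.closure s ∧ iSupIndep T := by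
  have hsup : sSup {a ≤ Submodule.span ℤ s | IsAtom a} = Submodule.span ℤ s := by
    refine le_antisymm (sSup_le fun a ha => ha.1) (Submodule.span_le.2 fun x hx => ?_)
    by_cases h0 : x = 0
    · rw [h0]
      exact zero_mem _
    · obtain ⟨p, hp, hpx⟩ := hs x hx
      have hmem : Submodule.span ℤ {x} ∈ {a ≤ Submodule.span ℤ s | IsAtom a} :=
        ⟨Submodule.span_mono (Set.singleton_subset_iff.2 hx),
          isAtom_span_singleton_of_prime_nsmul_eq_zero hp h0 hpx⟩
      exact le_sSup hmem (Submodule.mem_span_singleton_self x)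
  -- A supremum of atoms in the lattice of submodules is already the supremum of an independent set
  -- of atoms.
  obtain ⟨t, hind, ht, hatom⟩ := exists_sSupIndep_of_sSup_atoms _ hsup
  let e : AddSubgroup M ≃o Submodule ℤ M := AddSubgroup.toIntSubmodule
  have htors : ∀ x ∈ Submodule.span ℤ s, IsOfFinAddOrder x := by
    intro x hx
    induction hx using Submodule.span_induction with
    | mem x hx =>
      obtain ⟨p, hp, hpx⟩ := hs x hx
      exact isOfFinAddOrder_iff_nsmul_eq_zero.2 ⟨p, hp.pos, hpx⟩
    | zero => exact IsOfFinAddOrder.zero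
    | add x y _ _ hx hy => exact hx.add hy
    | smul n x _ hx => exact hx.zsmul
  refine ⟨t, fun j => e.symm j, fun j => ?_, ?_, ?_⟩
  -- An atom is cyclic on any of its nonzero elements, and these have finite order.
  · obtain ⟨y, hy, hy0⟩ := Submodule.exists_mem_ne_zero_of_ne_bot (hatom j.2).1
    have hj : Submodule.span ℤ {y} = j :=
      ((hatom j.2).le_iff.1 ((Submodule.span_singleton_le_iff_mem _ _).2 hy)).resolve_left
        (by simpa using hy0)
    have hfin : IsOfFinAddOrder y := htors y (ht ▸ le_sSup j.2 hy)
    have hset : ((e.symm j : AddSubgroup M) : Set M) = AddSubgroup.zmultiples y := by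
      ext z
      change z ∈ (j : Submodule ℤ M) ↔ _
      rw [← hj, Submodule.mem_span_singleton]
      exact AddSubgroup.mem_zmultiples_iff.symm
    rw [hset]
    exact finite_zmultiples.2 hfin
  · rw [← e.symm.map_iSup, ← sSup_eq_iSup', ht, e.symm_apply_eq]
    exact (AddSubgroup.toIntSubmodule_closure s).symm
  · exact (iSupIndep_map_orderIso_iff e.symm).2 (sSupIndep_iff t |>.1 hind)

end AddCommGroup

namespace SkewBrace

/-! ### Commutators and their finiteness. -/

section Commutators

variable {B : Type u} [SkewBrace B]

/-- The additive commutator `x + b - x - b`. -/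
def addComm (x b : B) : B := x + b - x - b

theorem addComm_eq_zero_iff (x b : B) : addComm x b = 0 ↔ x + b = b + x := by
  rw [addComm, sub_eq_zero, sub_eq_iff_eq_add]

theorem lam_eq_star_add (a b : B) : lam a b = star a b + b := by simp [star]

/-- Centrality in `(B,∘)` may be replaced by `star b x = 0`: when both stars vanish, `∘` agrees with
`+` on the pair `x`, `b`. -/
theorem mem_ann_iff {x : B} :
    x ∈ ann B ↔ ∀ b, star x b = 0 ∧ star b x = 0 ∧ addComm x b = 0 := by
  constructor
  · intro hx b
    obtain ⟨h1, h2, -⟩ := id hx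
    have h3 : lam b x = x := by
      rw [lam, Subgroup.mem_center_iff.1 hx.2.2, mul_eq_add_lam, h1,
        ← AddSubgroup.mem_center_iff.1 h2, neg_add_cancel_left]
    exact ⟨(star_eq_zero_iff _ _).2 (h1 b), (star_eq_zero_iff _ _).2 h3,
      (addComm_eq_zero_iff _ _).2 (AddSubgroup.mem_center_iff.1 h2 b).symm⟩
  · intro h
    simp only [star_eq_zero_iff, addComm_eq_zero_iff] at h
    refine ⟨fun b => (h b).1, AddSubgroup.mem_center_iff.2 fun b => (h b).2.2.symm,
      Subgroup.mem_center_iff.2 fun b => ?_⟩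
    rw [mul_eq_add_lam, mul_eq_add_lam, (h b).1, (h b).2.1, (h b).2.2]

theorem add_comm_of_mem_ann {x : B} (hx : x ∈ ann B) (b : B) : x + b = b + x :=
  (addComm_eq_zero_iff _ _).1 (mem_ann_iff.1 hx b).2.2

theorem lam_of_mem_ann {x : B} (hx : x ∈ ann B) (b : B) : lam b x = x :=
  (star_eq_zero_iff _ _).1 (mem_ann_iff.1 hx b).2.1

theorem lam_of_mem_ann_left {x : B} (hx : x ∈ ann B) (b : B) : lam x b = b := hx.1 b

theorem proj_eq_zero_iff (I : Ideal B) {x : B} : I.proj x = 0 ↔ x ∈ I := by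
  rw [← Ideal.proj_zero, eq_comm, Ideal.proj_eq_iff, neg_zero, zero_add]

theorem mem_comap_ann_iff (I : Ideal B) {x : B} :
    x ∈ I.comap (ann (B ⧸ I)) ↔ ∀ b, star x b ∈ I ∧ star b x ∈ I ∧ addComm x b ∈ I := by
  change I.proj x ∈ ann (B ⧸ I) ↔ _
  rw [mem_ann_iff, I.proj_surjective.forall]
  simp only [← proj_eq_zero_iff I]
  rfl

/-- Clear once membership is read as a condition on commutators; this is what lets the two series be
compared term by term. -/
theorem comap_ann_mono {I J : Ideal B} (h : I ≤ J) :
    I.comap (ann (B ⧸ I)) ≤ J.comap (ann (B ⧸ J)) := by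
  intro x hx
  rw [mem_comap_ann_iff] at *
  exact fun b => ⟨h (hx b).1, h (hx b).2.1, h (hx b).2.2⟩

/-- The element `x` takes only finitely many values in each of the commutator-like operations. -/
def FiniteCommutators (x : B) : Prop :=
  (Set.range (star x)).Finite ∧ (Set.range fun b => star b x).Finite ∧
    (Set.range (addComm x)).Finite

/-- Each operation is constant on the left cosets of a finite-index subgroup: additive cosets for
`star x b` and `addComm x b`, multiplicative ones for `star b x`. -/
theorem PropertyElt.finiteCommutators {x : B} (hx : PropertyElt x) : FiniteCommutators x := by
  obtain ⟨h1, h2⟩ := hx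
  have key1 : ∀ f : B → B, (∀ b, ∀ c ∈ fixR x ⊓ AddSubgroup.centralizer {x}, f (b + c) = f b) →
      (Set.range f).Finite := by
    intro f hf
    have : Finite (B ⧸ (fixR x ⊓ AddSubgroup.centralizer {x})) := inferInstance
    refine (Set.finite_range
      fun q : B ⧸ (fixR x ⊓ AddSubgroup.centralizer {x}) => f q.out).subset ?_
    rintro _ ⟨b, rfl⟩
    refine ⟨(b : B ⧸ (fixR x ⊓ AddSubgroup.centralizer {x})), ?_⟩
    obtain ⟨c, hc⟩ := QuotientAddGroup.mk_out_eq_add (fixR x ⊓ AddSubgroup.centralizer {x}) b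
    simp only [hc]
    exact hf b c c.2
  have key2 : ∀ f : B → B, (∀ b, ∀ c ∈ fixL x ⊓ Subgroup.centralizer {x}, f (b * c) = f b) →
      (Set.range f).Finite := by
    intro f hf
    have : Finite (B ⧸ (fixL x ⊓ Subgroup.centralizer {x})) := inferInstance
    refine (Set.finite_range
      fun q : B ⧸ (fixL x ⊓ Subgroup.centralizer {x}) => f q.out).subset ?_
    rintro _ ⟨b, rfl⟩
    refine ⟨(b : B ⧸ (fixL x ⊓ Subgroup.centralizer {x})), ?_⟩
    obtain ⟨c, hc⟩ := QuotientGroup.mk_out_eq_mul (fixL x ⊓ Subgroup.centralizer {x}) b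
    simp only [hc]
    exact hf b c c.2
  refine ⟨key1 _ ?_, key2 _ ?_, key1 _ ?_⟩
  · intro b c hc
    have hc' : lam x c = c := (star_eq_zero_iff _ _).1 hc.1
    rw [star, lam_add, hc', star, add_sub_add_right_eq_sub]
  · intro b c hc
    have hc' : lam c x = x := (star_eq_zero_iff _ _).1 hc.1
    simp only [star, lam_mul, hc']
  · intro b c hc
    have hc' : x + c = c + x := (AddSubgroup.mem_centralizer_singleton_iff.1 hc.2).symm
    have hc2 : c - x = -x + c := by
      rw [sub_eq_iff_eq_add, add_assoc, ← hc', neg_add_cancel_left]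
    rw [addComm, addComm, ← add_assoc x b c, add_sub_assoc, hc2, ← add_assoc,
      ← sub_eq_add_neg (x + b), add_sub_add_right_eq_sub]

theorem FiniteCommutators.proj (I : Ideal B) {x : B} (hx : FiniteCommutators x) :
    FiniteCommutators (I.proj x) := by
  obtain ⟨h1, h2, h3⟩ := hx
  refine ⟨(h1.image I.proj).subset ?_, (h2.image I.proj).subset ?_, (h3.image I.proj).subset ?_⟩
  all_goals
    rintro _ ⟨b, rfl⟩
    obtain ⟨b, rfl⟩ := I.proj_surjective b
    exact ⟨_, ⟨b, rfl⟩, rfl⟩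

end Commutators

/-! ### Elements whose commutators lie in the annihilator. -/

section SecondAnnihilator

variable {B : Type u} [SkewBrace B]

/-- The annihilating value `star x c` can be moved past `b`. The two analogues below make all three
operations additive in `b`, with `∘` as the source operation for `star b x`. -/
theorem star_add_of_mem_ann {x c : B} (hc : star x c ∈ ann B) (b : B) :
    star x (b + c) = star x b + star x c := by
  rw [star, lam_add, lam_eq_star_add x c, lam_eq_star_add x b, ← add_assoc,
    add_sub_add_right_eq_sub, add_assoc, ← add_comm_of_mem_ann hc, ← add_assoc,
    add_sub_cancel_right]

theorem star_mul_of_mem_ann {x c : B} (hc : star c x ∈ ann B) (b : B) :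
    star (b * c) x = star b x + star c x := by
  rw [star, lam_mul, lam_eq_star_add c x, lam_add, lam_of_mem_ann hc, lam_eq_star_add b x,
    ← add_assoc, add_sub_cancel_right, add_comm_of_mem_ann hc]

theorem addComm_add_of_mem_ann {x c : B} (hc : addComm x c ∈ ann B) (b : B) :
    addComm x (b + c) = addComm x b + addComm x c := by
  have h : x + c = addComm x c + (c + x) := by simp [addComm, sub_eq_add_neg, add_assoc]
  have h' : c - x = -x + addComm x c + c := by
    rw [sub_eq_iff_eq_add, add_assoc, add_assoc, ← h, neg_add_cancel_left]
  have h2 : x + (b + c) - x - (b + c) = x + b + (c - x) - c - b := by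
    simp [sub_eq_add_neg, add_assoc]
  rw [addComm, h2, h', ← add_assoc, add_sub_cancel_right, ← add_assoc, add_sub_assoc,
    sub_eq_add_neg (addComm x c), add_comm_of_mem_ann hc, ← add_assoc, addComm]
  simp [addComm, sub_eq_add_neg]

/-- An element all of whose multiples lie in a finite set has finite order. -/
theorem isOfFinAddOrder_of_forall_nsmul_mem {G : Type*} [AddGroup G] {s : Set G} (hs : s.Finite)
    {v : G} (h : ∀ n : ℕ, n • v ∈ s) : IsOfFinAddOrder v := by
  by_contra hv
  exact Set.infinite_range_of_injective (injective_nsmul_iff_not_isOfFinAddOrder.2 hv)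
    (hs.subset (Set.range_subset_iff.2 h))

/-- By additivity, the multiples of a commutator are again commutators of `x`, at `n • b` or `b ^
n`, so they form a finite set. -/
theorem FiniteCommutators.isOfFinAddOrder {x : B} (hx : FiniteCommutators x)
    (h : ∀ b, star x b ∈ ann B ∧ star b x ∈ ann B ∧ addComm x b ∈ ann B) (b : B) :
    IsOfFinAddOrder (star x b) ∧ IsOfFinAddOrder (star b x) ∧ IsOfFinAddOrder (addComm x b) := by
  refine ⟨isOfFinAddOrder_of_forall_nsmul_mem hx.1 fun n => ⟨n • b, ?_⟩,
    isOfFinAddOrder_of_forall_nsmul_mem hx.2.1 fun n => ⟨b ^ n, ?_⟩,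
    isOfFinAddOrder_of_forall_nsmul_mem hx.2.2 fun n => ⟨n • b, ?_⟩⟩
  · induction n with
    | zero => simp [star, lam_zero]
    | succ n ih => rw [succ_nsmul, star_add_of_mem_ann (h b).1, ih, succ_nsmul]
  · induction n with
    | zero => simp [star, lam_one]
    | succ n ih =>
      simp only at ih ⊢
      rw [pow_succ, star_mul_of_mem_ann (h b).2.1, ih, succ_nsmul]
  · induction n with
    | zero => simp [addComm]
    | succ n ih => rw [succ_nsmul, addComm_add_of_mem_ann (h b).2.2, ih, succ_nsmul]

theorem exists_nsmul_eq_zero_of_finite {G : Type*} [AddGroup G] {s : Set G} (hs : s.Finite)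
    (h : ∀ v ∈ s, IsOfFinAddOrder v) : ∃ k : ℕ, 0 < k ∧ ∀ v ∈ s, k • v = 0 := by
  refine ⟨∏ v ∈ hs.toFinset, addOrderOf v, Finset.prod_pos fun v hv =>
    (h v (hs.mem_toFinset.1 hv)).addOrderOf_pos, fun v hv => ?_⟩
  exact addOrderOf_dvd_iff_nsmul_eq_zero.1 (Finset.dvd_prod_of_mem _ (hs.mem_toFinset.2 hv))

theorem lam_nsmul (a b : B) (k : ℕ) : lam a (k • b) = k • lam a b := by
  induction k with
  | zero => simp [lam_zero]
  | succ k ih => rw [succ_nsmul, succ_nsmul, lam_add, ih]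

/-- Here `x * y` differs from `x + y` only by the factor `star x y`, which acts trivially. -/
theorem lam_lam_of_star_mem_ann {x y : B} (h : star x y ∈ ann B) (b : B) :
    lam x (lam y b) = lam (x + y) b := by
  have h1 : x * y = star x y * (x + y) := by
    rw [mul_eq_add_lam (star x y), lam_of_mem_ann_left h, mul_eq_add_lam, lam_eq_star_add,
      ← add_assoc, ← add_assoc, add_comm_of_mem_ann h]
  rw [← lam_mul, h1, lam_mul, lam_of_mem_ann_left h]

/-- The commutators of `k • x` are `k` times those of `x`, because annihilator values commute with
every summand they meet. -/
theorem nsmul_mem_ann {x : B} {k : ℕ}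
    (h : ∀ b, star x b ∈ ann B ∧ star b x ∈ ann B ∧ addComm x b ∈ ann B)
    (hk : ∀ b, k • star x b = 0 ∧ k • star b x = 0 ∧ k • addComm x b = 0) :
    k • x ∈ ann B := by
  refine mem_ann_iff.2 fun b => ⟨?_, ?_, ?_⟩
  · have key : ∀ n : ℕ, lam (n • x) b = n • star x b + b := by
      intro n
      induction n with
      | zero => rw [zero_nsmul, zero_nsmul, zero_add, ← one_eq_zero, lam_one]
      | succ n ih =>
        rw [succ_nsmul', ← lam_lam_of_star_mem_ann (h _).1, ih, lam_add, lam_nsmul,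
          lam_of_mem_ann (h b).1, lam_eq_star_add, succ_nsmul, add_assoc]
    rw [star, key, (hk b).1, zero_add, sub_self]
  · have hc : AddCommute (star b x) x := add_comm_of_mem_ann (h b).2.1 x
    rw [star, lam_nsmul, lam_eq_star_add, hc.add_nsmul, (hk b).2.1, zero_add, sub_self]
  · have hc : AddCommute (addComm x b) (b + x - b) := add_comm_of_mem_ann (h b).2.2 _
    -- Thus `x` is its conjugate plus a central element killed by `k`, so `k • x` equals its own
    -- conjugate.
    have h1 : x = addComm x b + (b + x - b) := by simp [addComm, sub_eq_add_neg, add_assoc]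
    have h2 : k • x = k • (b + x - b) := by
      conv_lhs => rw [h1, hc.add_nsmul, (hk b).2.2, zero_add]
    have h3 : ∀ n : ℕ, n • (b + x - b) = b + n • x - b := by
      intro n
      induction n with
      | zero => simp
      | succ n ih => rw [succ_nsmul, succ_nsmul, ih]; simp [sub_eq_add_neg, add_assoc]
    rw [addComm_eq_zero_iff]
    conv_lhs => rw [h2, h3, sub_add_cancel]

theorem FiniteCommutators.exists_nsmul_mem_ann {x : B} (hx : FiniteCommutators x)
    (h : ∀ b, star x b ∈ ann B ∧ star b x ∈ ann B ∧ addComm x b ∈ ann B) :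
    ∃ k : ℕ, 0 < k ∧ k • x ∈ ann B := by
  have ho := hx.isOfFinAddOrder h
  obtain ⟨k, hk, hk0⟩ := exists_nsmul_eq_zero_of_finite (hx.1.union (hx.2.1.union hx.2.2)) (by
    rintro _ (⟨b, rfl⟩ | ⟨b, rfl⟩ | ⟨b, rfl⟩)
    exacts [(ho b).1, (ho b).2.1, (ho b).2.2])
  exact ⟨k, hk, nsmul_mem_ann h fun b => ⟨hk0 _ (Or.inl ⟨b, rfl⟩),
    hk0 _ (Or.inr (Or.inl ⟨b, rfl⟩)), hk0 _ (Or.inr (Or.inr ⟨b, rfl⟩))⟩⟩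

theorem FiniteCommutators.exists_nsmul_mem_comap_ann (I : Ideal B) {x : B}
    (hx : FiniteCommutators x)
    (h : x ∈ (I.comap (ann (B ⧸ I))).comap (ann (B ⧸ I.comap (ann (B ⧸ I))))) :
    ∃ k : ℕ, 0 < k ∧ k • x ∈ I.comap (ann (B ⧸ I)) := by
  rw [mem_comap_ann_iff] at h
  obtain ⟨k, hk, hkx⟩ := (hx.proj I).exists_nsmul_mem_ann (by
    rw [I.proj_surjective.forall]
    exact h)
  exact ⟨k, hk, hkx⟩

end SecondAnnihilator

/-! ### Ideals inside the annihilator. -/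

section Series

variable (B : Type u) [SkewBrace B]

instance : AddCommGroup (ann B).toAddSubgroup where
  add_comm a b := Subtype.ext (add_comm_of_mem_ann a.2 b)

variable {B}

/-- A subgroup of the annihilator is an ideal. -/
def annIdeal (H : AddSubgroup (ann B).toAddSubgroup) : Ideal B where
  toAddSubgroup := H.map (ann B).toAddSubgroup.subtype
  lam_mem' := by
    rintro a _ ⟨x, hx, rfl⟩
    exact ⟨x, hx, (lam_of_mem_ann x.2 a).symm⟩
  add_conj_mem' := by
    rintro a _ ⟨x, hx, rfl⟩
    refine ⟨x, hx, ?_⟩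
    change (x : B) = a + x - a
    rw [← add_comm_of_mem_ann x.2, add_sub_cancel_right]
  mul_conj_mem' := by
    rintro a _ ⟨x, hx, rfl⟩
    refine ⟨x, hx, ?_⟩
    change (x : B) = a * x * a⁻¹
    rw [Subgroup.mem_center_iff.1 x.2.2.2, mul_inv_cancel_right]

theorem mem_annIdeal {H : AddSubgroup (ann B).toAddSubgroup} {x : B} :
    x ∈ annIdeal H ↔ ∃ hx : x ∈ ann B, (⟨x, hx⟩ : (ann B).toAddSubgroup) ∈ H :=
  ⟨fun ⟨y, hy, h⟩ => h ▸ ⟨y.2, hy⟩, fun ⟨hx, h⟩ => ⟨⟨x, hx⟩, h, rfl⟩⟩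

theorem annIdeal_le (H : AddSubgroup (ann B).toAddSubgroup) : annIdeal H ≤ ann B :=
  fun _ hx => (mem_annIdeal.1 hx).1

variable (B)

/-- Supplies the first term of the series. -/
theorem exists_torsionFree_ideal_le_ann :
    ∃ I : Ideal B, I.IsTorsionFree ∧ I ≤ ann B ∧ ∀ x ∈ ann B, ∃ k : ℕ, 0 < k ∧ k • x ∈ I := by
  obtain ⟨H, h1, h2⟩ := exists_torsionFree_addSubgroup_torsion_quotient (ann B).toAddSubgroup
  refine ⟨annIdeal H, fun x hx hfin => ?_, annIdeal_le H, fun x hx => ?_⟩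
  · obtain ⟨hx, hxH⟩ := mem_annIdeal.1 hx
    exact congrArg Subtype.val (h1 ⟨x, hx⟩ hxH
      (((ann B).toAddSubgroup.subtype_injective.isOfFinAddOrder_iff
        (f := (ann B).toAddSubgroup.subtype)).1 hfin))
  · obtain ⟨k, hk, hkx⟩ := h2 ⟨x, hx⟩
    exact ⟨k, hk, mem_annIdeal.2 ⟨_, hkx⟩⟩

/-- The ideal generated by the elements of prime order of the annihilator. -/
def annSocle : Ideal B :=
  annIdeal (AddSubgroup.closure {x | ∃ p : ℕ, p.Prime ∧ p • x = 0})

theorem annSocle_le_ann : annSocle B ≤ ann B := annIdeal_le _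

variable {B}

theorem mem_annSocle_of_prime_nsmul_eq_zero {x : B} (hx : x ∈ ann B) {p : ℕ} (hp : p.Prime)
    (hpx : p • x = 0) : x ∈ annSocle B :=
  mem_annIdeal.2 ⟨hx, AddSubgroup.subset_closure ⟨p, hp, Subtype.ext hpx⟩⟩

variable (B)

theorem exists_isRestrictedDirectProduct_annSocle :
    ∃ (ι : Type u) (T : ι → Ideal B), (∀ j, (T j : Set B).Finite) ∧
      (annSocle B).IsRestrictedDirectProduct T := by
  obtain ⟨ι, T, hfin, hsup, hind⟩ := exists_iSupIndep_finite_iSup_eq_closure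
    {x : (ann B).toAddSubgroup | ∃ p : ℕ, p.Prime ∧ p • x = 0} fun _ hx => hx
  refine ⟨ι, fun j => annIdeal (T j), fun j => (hfin j).image _, ?_, fun i => ?_⟩
  · change AddSubgroup.map _ _ = ⨆ j, AddSubgroup.map _ (T j)
    rw [← AddSubgroup.map_iSup, hsup]
  · change Disjoint (AddSubgroup.map _ (T i)) (⨆ j, ⨆ (_ : j ≠ i), AddSubgroup.map _ (T j))
    simp only [← AddSubgroup.map_iSup]
    rw [AddSubgroup.disjoint_def]
    rintro _ ⟨x, hx, rfl⟩ ⟨y, hy, h⟩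
    obtain rfl := Subtype.ext h
    rw [AddSubgroup.disjoint_def.1 (hind i) hx hy, map_zero]

/-! ### The socle series and its comparison with the annihilator series. -/

variable {B}

/-- The series with first term `I` in which each successive factor is the socle of the
annihilator of the quotient. -/
noncomputable def socleSeries (I : Ideal B) : ℕ → Ideal B
  | 0 => I
  | n + 1 => (socleSeries I n).comap (annSocle (B ⧸ socleSeries I n))

theorem socleSeries_mono (I : Ideal B) : Monotone (socleSeries I) :=
  monotone_nat_of_le_succ fun _ => Ideal.le_comap _ _

theorem socleSeries_succ_le (I : Ideal B) (n : ℕ) :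
    socleSeries I (n + 1) ≤ (socleSeries I n).comap (ann (B ⧸ socleSeries I n)) :=
  fun _ hx => annSocle_le_ann _ hx

/-- The index is shifted by one because the socle series starts inside `ann B`, the term of index
`1`. -/
theorem socleSeries_le_annSeries {I : Ideal B} (hI : I ≤ ann B) (n : ℕ) :
    socleSeries I n ≤ annSeries B ((n + 1 : ℕ) : Ordinal.{u}) := by
  induction n with
  | zero =>
    intro x hx
    have hx' := mem_ann_iff.1 (hI hx)
    rw [Nat.cast_add, Nat.cast_zero, Nat.cast_one, annSeries_add_one, annSeries_zero,
      mem_comap_ann_iff]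
    simpa only [Ideal.mem_bot] using hx'
  | succ n ih =>
    rw [Nat.cast_add, Nat.cast_one, annSeries_add_one]
    exact (socleSeries_succ_le I n).trans (comap_ann_mono ih)

/-- If `I ≤ Ann(B)` is torsion-free with `Ann(B) / I` torsion, then the annihilators of all the
quotients by the terms of the socle series are torsion. -/
theorem exists_nsmul_mem_socleSeries (hB : ∀ x : B, FiniteCommutators x) {I : Ideal B}
    (hI : I.IsTorsionFree) (hle : I ≤ ann B) (htors : ∀ x ∈ ann B, ∃ k : ℕ, 0 < k ∧ k • x ∈ I)
    (n : ℕ) : ∀ x ∈ (socleSeries I n).comap (ann (B ⧸ socleSeries I n)),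
      ∃ k : ℕ, 0 < k ∧ k • x ∈ socleSeries I n := by
  induction n with
  | zero =>
    intro x hx
    have hx' := (mem_comap_ann_iff I).1 hx
    -- The commutators of `x` lie in the torsion-free `I` and have finite order, so they vanish and
    -- `x` is in `ann B`.
    have ho := (hB x).isOfFinAddOrder
      fun b => ⟨hle (hx' b).1, hle (hx' b).2.1, hle (hx' b).2.2⟩
    exact htors x (mem_ann_iff.2 fun b => ⟨hI _ (hx' b).1 (ho b).1,
      hI _ (hx' b).2.1 (ho b).2.1, hI _ (hx' b).2.2 (ho b).2.2⟩)
  | succ n ih =>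
    intro x hx
    -- Modulo term `n`, `x` lies in the second annihilator, so a positive multiple drops into the
    -- first, which is torsion by induction.
    obtain ⟨k, hk, hkx⟩ := (hB x).exists_nsmul_mem_comap_ann _
      (comap_ann_mono (socleSeries_succ_le I n) hx)
    obtain ⟨l, hl, hlx⟩ := ih _ hkx
    refine ⟨k * l, Nat.mul_pos hk hl, socleSeries_mono I n.le_succ ?_⟩
    rwa [mul_nsmul]

/-- Each prime factor of `m` costs one step of the series. The quantifiers over `n` and `x` stay
inside, since for a product `a * b` the factor `b` is applied to `a • x`, and `a` then to `x` at a
later stage. -/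
theorem exists_mem_socleSeries_of_nsmul_mem (I : Ideal B) (m : ℕ) : ∀ (n : ℕ) (x : B), 0 < m →
    x ∈ (socleSeries I n).comap (ann (B ⧸ socleSeries I n)) → m • x ∈ socleSeries I n →
    ∃ N, x ∈ socleSeries I N := by
  induction m using Nat.recOnMul with
  | zero => exact fun _ _ h => absurd h (lt_irrefl 0)
  | one => exact fun n x _ _ h => ⟨n, by rwa [one_nsmul] at h⟩
  | prime p hp =>
    exact fun n x _ hx h => ⟨n + 1, mem_annSocle_of_prime_nsmul_eq_zero hx hp
      ((proj_eq_zero_iff _).2 h)⟩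
  | mul a b iha ihb =>
    intro n x hab hx h
    rw [mul_nsmul] at h
    obtain ⟨N, hN⟩ := ihb n (a • x) (Nat.pos_of_mul_pos_left hab) (nsmul_mem hx a) h
    refine iha (max n N) x (Nat.pos_of_mul_pos_right hab)
      (comap_ann_mono (socleSeries_mono I (le_max_left n N)) hx)
      (socleSeries_mono I (le_max_right n N) hN)

theorem exists_forall_mem_of_finite_of_monotone {S : ℕ → Ideal B} (hS : Monotone S) {s : Set B}
    (hs : s.Finite) (h : ∀ x ∈ s, ∃ n, x ∈ S n) : ∃ n, ∀ x ∈ s, x ∈ S n := by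
  choose! f hf using h
  obtain ⟨N, hN⟩ := (hs.image f).bddAbove
  exact ⟨N, fun x hx => hS (hN ⟨x, hx, rfl⟩) (hf x hx)⟩

/-- The successor step is where finiteness is decisive: finitely many commutators in an increasing
union lie in one term. -/
theorem annSeries_subset_iUnion_socleSeries (hB : ∀ x : B, FiniteCommutators x) {I : Ideal B}
    (hI : I.IsTorsionFree) (hle : I ≤ ann B) (htors : ∀ x ∈ ann B, ∃ k : ℕ, 0 < k ∧ k • x ∈ I)
    (α : Ordinal.{u}) : ∀ x ∈ annSeries B α, ∃ n, x ∈ socleSeries I n := by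
  induction α using Ordinal.limitRecOn with
  | zero =>
    intro x hx
    rw [annSeries_zero, Ideal.mem_bot] at hx
    exact ⟨0, hx ▸ zero_mem _⟩
  | add_one α ih =>
    intro x hx
    rw [annSeries_add_one, mem_comap_ann_iff] at hx
    obtain ⟨n, hn⟩ := exists_forall_mem_of_finite_of_monotone (socleSeries_mono I)
      ((hB x).1.union ((hB x).2.1.union (hB x).2.2)) (by
        rintro _ (⟨b, rfl⟩ | ⟨b, rfl⟩ | ⟨b, rfl⟩)
        exacts [ih _ (hx b).1, ih _ (hx b).2.1, ih _ (hx b).2.2])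
    have hxn : x ∈ (socleSeries I n).comap (ann (B ⧸ socleSeries I n)) :=
      (mem_comap_ann_iff _).2 fun b => ⟨hn _ (Or.inl ⟨b, rfl⟩),
        hn _ (Or.inr (Or.inl ⟨b, rfl⟩)), hn _ (Or.inr (Or.inr ⟨b, rfl⟩))⟩
    obtain ⟨k, hk, hkx⟩ := exists_nsmul_mem_socleSeries hB hI hle htors n x hxn
    exact exists_mem_socleSeries_of_nsmul_mem I k n x hk hxn hkx
  | limit μ hμ ih =>
    intro x hx
    have hx' : x ∈ (annSeries B μ : Set B) := hx
    rw [coe_annSeries_limit B hμ] at hx'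
    obtain ⟨β, hβ, hx'⟩ := Set.mem_iUnion₂.1 hx'
    exact ih β hβ x hx'

variable (B)

theorem annSeries_le_hyperAnn (α : Ordinal.{u}) : annSeries B α ≤ hyperAnn B := by
  rw [← annSeries_eq_hyperAnn B (le_max_right α (annLength B))]
  exact annSeries_mono B (le_max_left _ _)

end Series

end SkewBrace

/-! ### The main theorem. -/

theorem mainTheorem11 (B : Type u) [SkewBrace B] (hB : SkewBrace.PropertyS B) :
    (∃ S : ℕ → SkewBrace.Ideal B,
      Monotone S ∧
      (⋃ n, (S n : Set B)) = (SkewBrace.hyperAnn B : Set B) ∧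
      (S 0).IsTorsionFree ∧
      S 0 ≤ SkewBrace.ann B ∧
      ∀ i : ℕ,
        (S i).map (S (i + 1)) ≤ SkewBrace.ann (B ⧸ S i) ∧
        ∃ (ι : Type u) (T : ι → SkewBrace.Ideal (B ⧸ S i)),
          (∀ j, (T j : Set (B ⧸ S i)).Finite) ∧
          ((S i).map (S (i + 1))).IsRestrictedDirectProduct T) ∧
    SkewBrace.annLength B ≤ Ordinal.omega0 := by
  open SkewBrace in
  have hfin : ∀ x : B, FiniteCommutators x := fun x => (hB x).finiteCommutators
  obtain ⟨I, hI, hle, htors⟩ := exists_torsionFree_ideal_le_ann B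
  have hsub := annSeries_subset_iUnion_socleSeries hfin hI hle htors
  have hmap : ∀ i, (socleSeries I i).map (socleSeries I (i + 1)) =
      annSocle (B ⧸ socleSeries I i) := fun i => Ideal.map_comap _ _
  refine ⟨⟨socleSeries I, socleSeries_mono I, ?_, hI, hle, fun i => ⟨?_, ?_⟩⟩, ?_⟩
  · refine Set.Subset.antisymm (Set.iUnion_subset fun n x hx => ?_) fun x hx =>
      Set.mem_iUnion.2 (hsub _ x hx)
    exact annSeries_le_hyperAnn B _ (socleSeries_le_annSeries hle n hx)
  · rw [hmap]
    exact annSocle_le_ann _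
  · rw [hmap]
    exact exists_isRestrictedDirectProduct_annSocle _
  -- An element of the term of index `ω + 1` lies in some `socleSeries I n`, hence in the term of
  -- finite index `n + 1`.
  · refine csInf_le' (le_antisymm (annSeries_mono B (Order.lt_add_one_iff.2 le_rfl).le) ?_)
    intro x hx
    obtain ⟨n, hn⟩ := hsub _ x hx
    exact annSeries_mono B (Ordinal.natCast_lt_omega0 (n + 1)).le
      (socleSeries_le_annSeries hle n hn)
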